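/- Let $V$ be a finite set of variables. A constraint over $V$ is a pair $\langle (v,u),P\rangle$ of an ordered pair $(v,u)\in V^2$ and a predicate $P:\{0,1\}^2\to\{0,1\}$. A (Boolean, binary) VCSP instance is a triple $\mathcal I=(V,\Pi,w)$, where $\Pi$ is a finite set of constraints over $V$ and $w:\Pi\to[0,\infty)$. For an assignment $A:V\to\{0,1\}$ put $$\mathrm{Val}_{\mathcal I}(A)=\sum_{\langle (v,u),P\rangle\in\Pi} w(\langle (v,u),P\rangle)\cdot P(A(v),A(u)).$$ For $\varepsilon\in(0,1)$, an $\varepsilon$-sparsifier of $\mathcal I$ is an instance $\mathcal I_\varepsilon=(V,\Pi_\varepsilon,w_\varepsilon)$ with $\Pi_\varepsilon\subseteq\Pi$, with $w_\varepsilon:\Pi_\varepsilon\to[0,\infty)$ arbitrary, and with $$(1-\varepsilon)\,\mathrm{Val}_{\mathcal I}(A)\le \mathrm{Val}_{\mathcal I_\varepsilon}(A)\le(1+\varepsilon)\,\mathrm{Val}_{\mathcal I}(A)\qquad\text{for all }A:V\to\{0,1\}.$$ Let $\mathrm{nOr}$, $01$, $\mathrm{Dicut}$ and $\mathrm{And}$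 denote the predicates that take the value $1$ exactly at $(0,0)$, $(0,1)$, $(1,0)$ and $(1,1)$, respectively. **Theorem.** There is an absolute constant $C>0$ such that for every finite set $V$, every $\varepsilon\in(0,1)$ and every VCSP instance $\mathcal I=(V,\Pi,w)$ all of whose constraints $\langle (v,u),P\rangle\in\Pi$ satisfy $P\notin\{\mathrm{nOr},01,\mathrm{Dicut},\mathrm{And}\}$, there exists an $\varepsilon$-sparsifier $\mathcal I_\varepsilon=(V,\Pi_\varepsilon,w_\varepsilon)$ of $\mathcal I$ with $|\Pi_\varepsilon|\le C\,|V|/\varepsilon^2$. -/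

import Mathlib

open scoped NNReal

/-- A predicate `P : {0,1}² → {0,1}`, with `false` for `0` and `true` for `1`. -/
abbrev BoolPred : Type := Bool → Bool → Bool

namespace BoolPred

/-- `nOr (x, y) = 1` iff `x = 0` and `y = 0`. -/
def nOr : BoolPred := fun x y => !x && !y

/-- The predicate `01`: it is `1` at `(x, y)` iff `x = 0` and `y = 1`. -/
def zeroOne : BoolPred := fun x y => !x && y

/-- `Dicut (x, y) = 1` iff `x = 1` and `y = 0`. -/
def dicut : BoolPred := fun x y => x && !y

/-- `And (x, y) = 1` iff `x = 1` and `y = 1`. -/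
def and : BoolPred := fun x y => x && y

end BoolPred

/-- A constraint `⟨(v, u), P⟩` over the variables `V`: an ordered pair of variables and a
predicate. -/
structure BinConstraint (V : Type*) where
  /-- The first variable `v`. -/
  fst : V
  /-- The second variable `u`. -/
  snd : V
  /-- The predicate `P`. -/
  pred : BoolPred

/-- The assignment `A : V → {0,1}` satisfies the constraint `⟨(v, u), P⟩`: `P (A v, A u) = 1`. -/
def BinConstraint.Satisfied {V : Type*} (π : BinConstraint V) (A : V → Bool) : Prop :=
  π.pred (A π.fst) (A π.snd) = true

instance BinConstraint.instDecidableSatisfied {V : Type*} (π : BinConstraint V) (A : V → Bool) :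
    Decidable (π.Satisfied A) :=
  inferInstanceAs (Decidable (π.pred (A π.fst) (A π.snd) = true))

/-- A VCSP instance `(V, Π, w)` with two-variable Boolean constraints: a finite set `Π` of
constraints over `V` and a nonnegative weight for each member of `Π`. -/
structure BinVCSP (V : Type*) where
  /-- The set of constraints `Π`. -/
  constraints : Finset (BinConstraint V)
  /-- The weight function `w : Π → ℝ₊`. -/
  weight : {π : BinConstraint V // π ∈ constraints} → ℝ≥0

namespace BinVCSP

/-- The value of an assignment: the total weight of the constraints that it satisfies. -/
def value {V : Type*} (I : BinVCSP V) (A : V → Bool) : ℝ :=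
  ∑ π : {π : BinConstraint V // π ∈ I.constraints},
    (I.weight π : ℝ) * (if π.1.Satisfied A then 1 else 0)

/-- `J` is an `ε`-sparsifier of `I`: a re-weighted sub-instance on the same variables with
`Val_J(A) ∈ (1 ± ε) · Val_I(A)` for every assignment `A`. -/
structure IsSparsifier {V : Type*} (ε : ℝ) (J I : BinVCSP V) : Prop where
  /-- The constraints of `J` are among those of `I`. -/
  subset : J.constraints ⊆ I.constraints
  /-- The value of every assignment is preserved up to a factor `1 ± ε`. -/
  value_mem : ∀ A : V → Bool,
    J.value A ∈ Set.Icc ((1 - ε) * I.value A) ((1 + ε) * I.value A)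

end BinVCSP

/-! Each allowed predicate equals `‖a + b x + c y‖ ^ 2` on `{0,1}²` for suitable complex `a, b, c`
(`BoolPred.exists_norm_sq_eq`). An affine function vanishing at three corners of the square vanishes
at the fourth, so the four excluded predicates are exactly those without such a form. Complex
coefficients matter for a predicate with three satisfying inputs: there two unit numbers must have a
sum of modulus one.

After multiplication by the square roots of the weights, `Val(A)` is the sum of the squared moduli
of the coordinates of a vector in the range of a linear map out of `ℂ^(|V|+1)`. Sparsifying the
instance thus reduces to reweighting squared coordinates on a subspace of dimension `r ≤ |V| + 1`
(`Submodule.exists_sparse_coordinates`). In an orthonormal basis of the subspace this is a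
decomposition of the identity into rank-one matrices, to which the Batson–Spielman–Srivastava
barrier argument applies (`BarrierBounds.step`, `exists_sparse_isotropic`). It keeps `O(r / ε²)`
terms. -/

open scoped ComplexOrder

/-! ### Rank-one matrices, quadratic forms and traces. -/

namespace Matrix

variable {n : Type*}

/-- The rank-one Hermitian matrix `v v*`. -/
def outer (v : n → ℂ) : Matrix n n ℂ := vecMulVec v (star v)

lemma outer_isHermitian (v : n → ℂ) : (outer v).IsHermitian := by
  ext i j; simp [outer, vecMulVec_apply, mul_comm]

variable [Fintype n]

/-- The real part of the sesquilinear form of a complex matrix on the diagonal. -/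
def reForm (M : Matrix n n ℂ) (v : n → ℂ) : ℝ := (star v ⬝ᵥ M *ᵥ v).re

/-- The real part of the trace of a complex matrix. -/
def reTrace (M : Matrix n n ℂ) : ℝ := M.trace.re

lemma reTrace_add (M N : Matrix n n ℂ) : reTrace (M + N) = reTrace M + reTrace N := by
  simp [reTrace, trace_add]

lemma reTrace_sub (M N : Matrix n n ℂ) : reTrace (M - N) = reTrace M - reTrace N := by
  simp [reTrace, trace_sub]

lemma reTrace_smul (s : ℝ) (M : Matrix n n ℂ) : reTrace (s • M) = s * reTrace M := by
  simp [reTrace, trace_smul]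

lemma reTrace_mul_comm (M N : Matrix n n ℂ) : reTrace (M * N) = reTrace (N * M) := by
  rw [reTrace, trace_mul_comm, reTrace]

lemma reForm_add (M N : Matrix n n ℂ) (v : n → ℂ) :
    reForm (M + N) v = reForm M v + reForm N v := by
  simp [reForm, add_mulVec]

lemma reForm_sub (M N : Matrix n n ℂ) (v : n → ℂ) :
    reForm (M - N) v = reForm M v - reForm N v := by
  simp [reForm, sub_mulVec]

lemma reForm_smul (s : ℝ) (M : Matrix n n ℂ) (v : n → ℂ) :
    reForm (s • M) v = s * reForm M v := by
  simp [reForm, smul_mulVec]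

lemma reForm_zero_right (M : Matrix n n ℂ) : reForm M 0 = 0 := by simp [reForm]

lemma reForm_outer (v x : n → ℂ) : reForm (outer v) x = ‖star v ⬝ᵥ x‖ ^ 2 := by
  rw [reForm, outer, vecMulVec_mulVec, op_smul_eq_smul, dotProduct_smul, smul_eq_mul,
    star_dotProduct x v,
    Complex.star_def, Complex.mul_conj, Complex.ofReal_re, Complex.normSq_eq_norm_sq]

lemma reForm_sum_smul_outer {ι : Type*} [Fintype ι] {v : ι → n → ℂ} (s : ι → ℝ)
    (x : n → ℂ) :
    reForm (∑ i, s i • outer (v i)) x = ∑ i, s i * ‖star (v i) ⬝ᵥ x‖ ^ 2 := by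
  simp_rw [← reForm_outer, ← reForm_smul]
  simp only [reForm, sum_mulVec, dotProduct_sum, Complex.re_sum]

lemma outer_mul_mul_outer (M : Matrix n n ℂ) (v : n → ℂ) :
    outer v * M * outer v = (star v ⬝ᵥ M *ᵥ v) • outer v := by
  rw [outer, vecMulVec_mul, vecMulVec_mul_vecMulVec, ← dotProduct_mulVec, vecMulVec_smul]

lemma reTrace_mul_outer (M : Matrix n n ℂ) (v : n → ℂ) :
    reTrace (M * outer v) = reForm M v := by
  rw [reTrace, outer, mul_vecMulVec, trace_vecMulVec, dotProduct_comm, reForm]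

lemma sum_reForm [DecidableEq n] {ι : Type*} [Fintype ι] {v : ι → n → ℂ}
    (hv : ∑ i, outer (v i) = 1) (M : Matrix n n ℂ) : ∑ i, reForm M (v i) = reTrace M := by
  simp_rw [← reTrace_mul_outer, reTrace]
  rw [← Complex.re_sum, ← trace_sum, ← Finset.mul_sum, hv, mul_one]

lemma IsHermitian.coe_reForm {M : Matrix n n ℂ} (hM : M.IsHermitian) (v : n → ℂ) :
    ((reForm M v : ℝ) : ℂ) = star v ⬝ᵥ M *ᵥ v := by
  have := hM.im_star_dotProduct_mulVec_self v
  apply Complex.ext <;> simp_all [reForm]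

lemma PosDef.reForm_pos {M : Matrix n n ℂ} (hM : M.PosDef) {v : n → ℂ} (hv : v ≠ 0) :
    0 < reForm M v := (Complex.lt_def.1 (hM.dotProduct_mulVec_pos hv)).1

lemma PosSemidef.reForm_nonneg {M : Matrix n n ℂ} (hM : M.PosSemidef) (v : n → ℂ) :
    0 ≤ reForm M v := (Complex.le_def.1 (hM.dotProduct_mulVec_nonneg v)).1

lemma PosDef.reTrace_pos [Nonempty n] {M : Matrix n n ℂ} (hM : M.PosDef) : 0 < reTrace M :=
  (Complex.lt_def.1 hM.trace_pos).1

lemma PosSemidef.reTrace_nonneg {M : Matrix n n ℂ} (hM : M.PosSemidef) : 0 ≤ reTrace M :=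
  (Complex.le_def.1 hM.trace_nonneg).1

lemma IsHermitian.posDef_of_reForm_pos {M : Matrix n n ℂ} (hM : M.IsHermitian)
    (h : ∀ v, v ≠ 0 → 0 < reForm M v) : M.PosDef := by
  refine PosDef.of_dotProduct_mulVec_pos hM fun {v} hv => ?_
  rw [← hM.coe_reForm]
  exact_mod_cast h v hv

variable [DecidableEq n]

lemma PosDef.mul_inv_self {P : Matrix n n ℂ} (hP : P.PosDef) : P * P⁻¹ = 1 :=
  mul_nonsing_inv _ ((isUnit_iff_isUnit_det _).1 hP.isUnit)

lemma PosDef.inv_mul_self {P : Matrix n n ℂ} (hP : P.PosDef) : P⁻¹ * P = 1 :=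
  nonsing_inv_mul _ ((isUnit_iff_isUnit_det _).1 hP.isUnit)

/-- The Cauchy–Schwarz inequality for the dual norms of `P` and `P⁻¹`. -/
lemma PosDef.norm_sq_dotProduct_le {P : Matrix n n ℂ} (hP : P.PosDef) (v x : n → ℂ) :
    ‖star v ⬝ᵥ x‖ ^ 2 ≤ reForm P⁻¹ v * reForm P x := by
  rcases eq_or_ne v 0 with rfl | hv
  · simp [reForm_zero_right]
  have hρ := hP.inv.reForm_pos hv
  have hρc := hP.inv.isHermitian.coe_reForm v
  have hxc := hP.isHermitian.coe_reForm x
  set ρ := reForm P⁻¹ v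
  set y := P⁻¹ *ᵥ v with hy
  set c := star v ⬝ᵥ x with hc
  have hPy : P *ᵥ y = v := by rw [hy, mulVec_mulVec, hP.mul_inv_self, one_mulVec]
  have hxv : star x ⬝ᵥ v = star c := star_dotProduct x v
  have hyv : star y ⬝ᵥ v = ρ := by
    have : star y ⬝ᵥ v = star (star v ⬝ᵥ y) := star_dotProduct y v
    rw [this, ← hρc]; simp
  have hyx : star y ⬝ᵥ P *ᵥ x = c := by
    rw [dotProduct_mulVec, ← star_star (star y ᵥ* P), star_vecMul, star_star,
      hP.isHermitian.eq, hPy]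
  -- The form of `P` at `ρ x - c y`, a multiple of the `P`-orthogonal projection of `x` off `y = P⁻¹
  -- v`, is nonnegative.
  have key : star ((ρ : ℂ) • x - c • y) ⬝ᵥ P *ᵥ ((ρ : ℂ) • x - c • y)
      = ((ρ * (ρ * reForm P x - ‖c‖ ^ 2) : ℝ) : ℂ) := by
    have hcc : star c * c = ((‖c‖ ^ 2 : ℝ) : ℂ) := by
      rw [Complex.star_def, ← Complex.normSq_eq_conj_mul_self, Complex.normSq_eq_norm_sq]
    rw [mulVec_sub, mulVec_smul, mulVec_smul, hPy, star_sub, star_smul, star_smul]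
    simp only [sub_dotProduct, dotProduct_sub, smul_dotProduct, dotProduct_smul, smul_eq_mul,
      hxv, hyv, hyx, ← hxc]
    push_cast at hcc ⊢
    rw [← hcc]
    simp only [Complex.star_def, Complex.conj_ofReal]
    ring
  have h0 := (Complex.le_def.1 (hP.posSemidef.dotProduct_mulVec_nonneg ((ρ : ℂ) • x - c • y))).1
  rw [key, Complex.ofReal_re, Complex.zero_re] at h0
  nlinarith [nonneg_of_mul_nonneg_right h0 hρ]

/-- A rank-one perturbation `P + s v v*` of a positive definite matrix stays positive definite
as long as `1 + s v* P⁻¹ v` is positive. -/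
lemma PosDef.add_smul_outer {P : Matrix n n ℂ} (hP : P.PosDef) (v : n → ℂ) {s : ℝ}
    (hs : 0 < 1 + s * reForm P⁻¹ v) : (P + s • outer v).PosDef := by
  refine IsHermitian.posDef_of_reForm_pos
    (hP.isHermitian.add ((outer_isHermitian v).smul (by simp [IsSelfAdjoint]))) fun x hx => ?_
  rw [reForm_add, reForm_smul, reForm_outer]
  have h1 := hP.norm_sq_dotProduct_le v x
  have h2 := hP.reForm_pos hx
  rcases le_total 0 s with h | h
  · positivity
  · nlinarith [mul_le_mul_of_nonneg_left h1 (neg_nonneg.2 h), mul_pos hs h2]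

/-- The trace form of the Sherman–Morrison formula. -/
lemma PosDef.reTrace_inv_add_smul_outer {P : Matrix n n ℂ} (hP : P.PosDef) (v : n → ℂ) {s : ℝ}
    (hs : 0 < 1 + s * reForm P⁻¹ v) :
    reTrace (P + s • outer v)⁻¹ =
      reTrace P⁻¹ - s * reForm (P⁻¹ * P⁻¹) v / (1 + s * reForm P⁻¹ v) := by
  set κ := s / (1 + s * reForm P⁻¹ v) with hκ
  have hκ' : κ * (1 + s * reForm P⁻¹ v) = s := div_mul_cancel₀ _ hs.ne'
  have hX : outer v * P⁻¹ * outer v = reForm P⁻¹ v • outer v := by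
    rw [outer_mul_mul_outer, ← hP.inv.isHermitian.coe_reForm v, Complex.coe_smul]
  have hinv : (P + s • outer v)⁻¹ = P⁻¹ - κ • (P⁻¹ * outer v * P⁻¹) := by
    refine inv_eq_right_inv ?_
    have e1 : P * (P⁻¹ * outer v * P⁻¹) = outer v * P⁻¹ := by
      rw [← mul_assoc, ← mul_assoc, hP.mul_inv_self, one_mul]
    have e2 : outer v * (P⁻¹ * outer v * P⁻¹) = reForm P⁻¹ v • (outer v * P⁻¹) := by
      rw [← mul_assoc, ← mul_assoc, hX, smul_mul_assoc]
    rw [add_mul, mul_sub, mul_sub, hP.mul_inv_self, mul_smul_comm, mul_smul_comm, e1,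
      smul_mul_assoc, smul_mul_assoc, e2, smul_smul, smul_smul, sub_add, ← sub_smul, ← sub_smul]
    rw [show κ - (s - κ * s * reForm P⁻¹ v) = 0 by linarith, zero_smul, sub_zero]
  rw [hinv, reTrace_sub, reTrace_smul, mul_assoc, reTrace_mul_comm, mul_assoc,
    reTrace_mul_comm, reTrace_mul_outer, hκ]
  ring

end Matrix

/-! ### Resolvent identities and trace inequalities. -/

namespace Matrix

variable {n : Type*} [DecidableEq n]

lemma PosDef.smul_one {δ : ℝ} (hδ : 0 < δ) : (δ • (1 : Matrix n n ℂ)).PosDef :=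
  PosDef.one.smul hδ

lemma PosDef.add_smul_one {P : Matrix n n ℂ} {δ : ℝ} (hP : P.PosDef) (hδ : 0 < δ) :
    (P + δ • 1).PosDef :=
  hP.add (.smul_one hδ)

variable [Fintype n]

lemma PosDef.mul_mul_same {M N : Matrix n n ℂ} (hM : M.PosDef) (hN : N.PosDef) :
    (M * N * M).PosDef := by
  have := (IsUnit.posDef_star_left_conjugate_iff (x := N) hM.isUnit).2 hN
  rwa [star_eq_conjTranspose, hM.isHermitian.eq] at this

lemma PosDef.mul_self {M : Matrix n n ℂ} (hM : M.PosDef) : (M * M).PosDef := by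
  simpa using hM.mul_mul_same PosDef.one

section Resolvent

variable {P : Matrix n n ℂ} {δ : ℝ}

lemma PosDef.inv_sub_inv (hP : P.PosDef) (hδ : 0 < δ) :
    P⁻¹ - (P + δ • 1)⁻¹ = δ • (P⁻¹ * (P + δ • 1)⁻¹) := by
  have hQ := hP.add_smul_one hδ
  calc P⁻¹ - (P + δ • 1)⁻¹ = P⁻¹ * ((P + δ • 1) - P) * (P + δ • 1)⁻¹ := by
        rw [mul_sub, sub_mul, mul_assoc, hQ.mul_inv_self, hP.inv_mul_self, mul_one, one_mul]
    _ = _ := by rw [add_sub_cancel_left, mul_smul_comm, mul_one, smul_mul_assoc]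

lemma PosDef.inv_sub_inv' (hP : P.PosDef) (hδ : 0 < δ) :
    P⁻¹ - (P + δ • 1)⁻¹ = δ • ((P + δ • 1)⁻¹ * P⁻¹) := by
  have hQ := hP.add_smul_one hδ
  calc P⁻¹ - (P + δ • 1)⁻¹ = (P + δ • 1)⁻¹ * ((P + δ • 1) - P) * P⁻¹ := by
        rw [mul_sub, sub_mul, hQ.inv_mul_self, one_mul, mul_assoc, hP.mul_inv_self, mul_one]
    _ = _ := by rw [add_sub_cancel_left, mul_smul_comm, mul_one, smul_mul_assoc]

lemma PosDef.reTrace_inv_sub (hP : P.PosDef) (hδ : 0 < δ) :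
    reTrace P⁻¹ - reTrace (P + δ • 1)⁻¹ = δ * reTrace (P⁻¹ * (P + δ • 1)⁻¹) := by
  rw [← reTrace_sub, hP.inv_sub_inv hδ, reTrace_smul]

/-- Resolvent identity: the difference of the two sides is `δ` times the trace of a positive
definite matrix. It bounds the cost of a step at the upper barrier. -/
lemma PosDef.reTrace_inv_mul_self_le (hP : P.PosDef) (hδ : 0 < δ) :
    reTrace ((P + δ • 1)⁻¹ * (P + δ • 1)⁻¹) ≤ reTrace (P⁻¹ * (P + δ • 1)⁻¹) := by
  have hQ := hP.add_smul_one hδ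
  have h : P⁻¹ * (P + δ • 1)⁻¹ = (P + δ • 1)⁻¹ * (P + δ • 1)⁻¹
      + δ • ((P + δ • 1)⁻¹ * P⁻¹ * (P + δ • 1)⁻¹) := by
    rw [← smul_mul_assoc, ← add_mul, ← hP.inv_sub_inv' hδ, add_sub_cancel]
  have := (hQ.inv.mul_mul_same hP.inv).posSemidef.reTrace_nonneg
  rw [h, reTrace_add, reTrace_smul]
  nlinarith [mul_nonneg hδ.le this]

lemma PosDef.reTrace_inv_mul_inv_pos [Nonempty n] (hP : P.PosDef) (hδ : 0 < δ) :
    0 < reTrace (P⁻¹ * (P + δ • 1)⁻¹) :=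
  (hP.add_smul_one hδ).inv.mul_self.reTrace_pos.trans_le (hP.reTrace_inv_mul_self_le hδ)

lemma PosDef.reTrace_inv_mul_self_eq (hP : P.PosDef) (hδ : 0 < δ) :
    reTrace (P⁻¹ * P⁻¹) = reTrace (P⁻¹ * (P + δ • 1)⁻¹)
      + δ * reTrace (P⁻¹ * (P + δ • 1)⁻¹ * P⁻¹) := by
  rw [← reTrace_smul, ← reTrace_add, mul_assoc, ← mul_smul_comm, ← mul_add, ← hP.inv_sub_inv' hδ,
    add_sub_cancel]

end Resolvent

/-- The Cauchy–Schwarz inequality for the trace form weighted by `T`. -/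
lemma PosDef.reTrace_mul_sq_le [Nonempty n] {R T : Matrix n n ℂ} (hR : R.PosDef) (hT : T.PosDef) :
    reTrace (R * T) ^ 2 ≤ reTrace T * reTrace (R * T * R) := by
  have hc := (hR.mul_mul_same hT).reTrace_pos
  -- The minimiser of the nonnegative quadratic `x ↦ tr ((1 - x R) T (1 - x R))`.
  set x := reTrace (R * T) / reTrace (R * T * R) with hx
  have h := (hT.posSemidef.conjTranspose_mul_mul_same (1 - x • R)).reTrace_nonneg
  have hH : (1 - x • R)ᴴ = 1 - x • R := by
    rw [conjTranspose_sub, conjTranspose_one, conjTranspose_smul, hR.isHermitian.eq, star_trivial]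
  have e : (1 - x • R) * T * (1 - x • R) = T - x • (R * T) - x • (T * R) + (x * x) • (R * T * R) := by
    simp only [sub_mul, mul_sub, one_mul, mul_one, smul_mul_assoc, mul_smul_comm, smul_sub, smul_smul]
    abel
  rw [hH, e, reTrace_add, reTrace_sub, reTrace_sub, reTrace_smul, reTrace_smul, reTrace_smul,
    reTrace_mul_comm T R] at h
  have hxc : x * reTrace (R * T * R) = reTrace (R * T) := div_mul_cancel₀ _ hc.ne'
  rw [mul_assoc x x, hxc] at h
  have h1 := mul_nonneg h hc.le
  have h2 : x * reTrace (R * T) * reTrace (R * T * R) = reTrace (R * T) ^ 2 := by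
    rw [mul_right_comm, hxc, sq]
  linarith

lemma PosDef.reForm_le_reTrace_mul {S : Matrix n n ℂ} (hS : S.PosDef) (x : n → ℂ) :
    reForm S x ≤ reTrace S * reForm 1 x := by
  rcases eq_or_ne x 0 with rfl | hx
  · simp [reForm_zero_right]
  have hN := (PosDef.one (n := n) (R := ℂ)).reForm_pos hx
  set N := reForm (1 : Matrix n n ℂ) x
  have ho : outer x * outer x = N • outer x := by
    have := outer_mul_mul_outer 1 x
    rwa [mul_one, ← PosDef.one.isHermitian.coe_reForm, Complex.coe_smul] at this
  have hZ : (N • (1 : Matrix n n ℂ) - outer x).IsHermitian :=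
    (isHermitian_one.smul (by simp [IsSelfAdjoint])).sub (outer_isHermitian x)
  -- `N • 1 - outer x` is `N` times an orthogonal projection, so its product with `S` has
  -- nonnegative trace.
  have h := (hS.posSemidef.mul_mul_conjTranspose_same
    (N • (1 : Matrix n n ℂ) - outer x)).reTrace_nonneg
  have hZZ : (N • (1 : Matrix n n ℂ) - outer x) * (N • (1 : Matrix n n ℂ) - outer x)
      = N • (N • (1 : Matrix n n ℂ) - outer x) := by
    simp only [sub_mul, mul_sub, one_mul, mul_one, smul_mul_assoc, mul_smul_comm, smul_sub, ho]
    abel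
  rw [hZ.eq, reTrace_mul_comm, ← mul_assoc, hZZ, smul_mul_assoc, reTrace_smul, reTrace_mul_comm,
    mul_sub, reTrace_sub, mul_smul_comm, mul_one, reTrace_smul, reTrace_mul_outer] at h
  nlinarith [nonneg_of_mul_nonneg_right h hN]

/-- A positive definite matrix whose inverse has trace less than `1 / δ` exceeds `δ`. -/
lemma PosDef.sub_smul_one {Q : Matrix n n ℂ} (hQ : Q.PosDef) {δ : ℝ} (hδ : 0 < δ)
    (h : δ * reTrace Q⁻¹ < 1) : (Q - δ • 1).PosDef := by
  refine IsHermitian.posDef_of_reForm_pos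
    (hQ.isHermitian.sub (PosDef.smul_one hδ).isHermitian) fun x hx => ?_
  have hN := (PosDef.one (n := n) (R := ℂ)).reForm_pos hx
  have h1 := hQ.norm_sq_dotProduct_le x x
  have h2 := hQ.inv.reForm_le_reTrace_mul x
  have h3 := hQ.reForm_pos hx
  have h4 : ‖star x ⬝ᵥ x‖ = reForm 1 x := by
    have := (PosDef.one (n := n) (R := ℂ)).isHermitian.coe_reForm x
    rw [one_mulVec] at this
    rw [← this, Complex.norm_real, Real.norm_of_nonneg hN.le]
  rw [h4] at h1
  rw [reForm_sub, reForm_smul]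
  set N := reForm (1 : Matrix n n ℂ) x
  have h5 : N * N ≤ N * (reTrace Q⁻¹ * reForm Q x) := by nlinarith
  have h6 := le_of_mul_le_mul_left h5 hN
  nlinarith

/-! ### The two-sided barrier step. -/

section Barrier

/-- The barriers `l < A < u` hold, with potentials at most `b` and `a`. -/
structure BarrierBounds (A : Matrix n n ℂ) (l u a b : ℝ) : Prop where
  upper : (u • 1 - A).PosDef
  lower : (A - l • 1).PosDef
  upper_le : reTrace (u • 1 - A)⁻¹ ≤ a
  lower_le : reTrace (A - l • 1)⁻¹ ≤ b

/-- By Sherman–Morrison, `1 / t` at least the bracket keeps the growth of the potential within `Δ`,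
which is what moving the upper barrier gains. -/
lemma PosDef.sub_smul_outer_of_le {Q : Matrix n n ℂ} (hQ : Q.PosDef) {v : n → ℂ} (hv : v ≠ 0)
    {t Δ : ℝ} (ht : 0 < t) (hΔ : 0 < Δ)
    (h : t * (reForm (Q⁻¹ * Q⁻¹) v / Δ + reForm Q⁻¹ v) ≤ 1) :
    (Q - t • outer v).PosDef ∧ reTrace (Q - t • outer v)⁻¹ ≤ reTrace Q⁻¹ + Δ := by
  have hq := hQ.inv.mul_self.reForm_pos hv
  have hqΔ : 0 < t * (reForm (Q⁻¹ * Q⁻¹) v / Δ) := by positivity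
  have hs : 0 < 1 + -t * reForm Q⁻¹ v := by linarith
  rw [sub_eq_add_neg, ← neg_smul]
  refine ⟨hQ.add_smul_outer v hs, ?_⟩
  rw [hQ.reTrace_inv_add_smul_outer v hs, sub_eq_add_neg, ← neg_div]
  gcongr
  rw [div_le_iff₀ hs]
  have h2 : t * (reForm (Q⁻¹ * Q⁻¹) v / Δ) ≤ 1 + -t * reForm Q⁻¹ v := by linarith
  rw [← mul_div_assoc, div_le_iff₀ hΔ] at h2
  linarith

/-- Mirror image: `1 / t` at most the bracket lowers the potential by at least `Δ`, which is what
moving the lower barrier costs. -/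
lemma PosDef.add_smul_outer_of_le {Q : Matrix n n ℂ} (hQ : Q.PosDef) {v : n → ℂ}
    {t Δ : ℝ} (ht : 0 < t) (hΔ : 0 < Δ)
    (h : 1 ≤ t * (reForm (Q⁻¹ * Q⁻¹) v / Δ - reForm Q⁻¹ v)) :
    (Q + t • outer v).PosDef ∧ reTrace (Q + t • outer v)⁻¹ ≤ reTrace Q⁻¹ - Δ := by
  have hρ := hQ.inv.posSemidef.reForm_nonneg v
  have hs : 0 < 1 + t * reForm Q⁻¹ v := by positivity
  refine ⟨hQ.add_smul_outer v hs, ?_⟩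
  rw [hQ.reTrace_inv_add_smul_outer v hs]
  gcongr
  rw [le_div_iff₀ hs]
  have h2 : 1 + t * reForm Q⁻¹ v ≤ t * (reForm (Q⁻¹ * Q⁻¹) v / Δ) := by linarith
  rw [← mul_div_assoc, le_div_iff₀ hΔ] at h2
  linarith

/-- One step of the Batson–Spielman–Srivastava barrier argument. -/
lemma BarrierBounds.step [Nonempty n] {ι : Type*} [Fintype ι] {v : ι → n → ℂ}
    (hv : ∑ i, outer (v i) = 1) {A : Matrix n n ℂ} {l u a b δL δU : ℝ}
    (hA : BarrierBounds A l u a b) (hL : 0 < δL) (hU : 0 < δU) (hb : δL * b < 1)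
    (hab : 1 / δU + a ≤ 1 / δL - b) :
    ∃ i, ∃ t : ℝ, 0 < t ∧ BarrierBounds (A + t • outer (v i)) (l + δL) (u + δU) a b := by
  obtain ⟨hP, hN, hPa, hNb⟩ := hA
  set P := u • 1 - A with hPdef
  have hQ := hP.add_smul_one hU
  have hPQ := hP.reTrace_inv_sub hU
  have hPQpos := hP.reTrace_inv_mul_inv_pos hU
  have hTT := hP.reTrace_inv_mul_self_le hU
  set Q := P + δU • 1 with hQdef
  set ΔU := reTrace P⁻¹ - reTrace Q⁻¹ with hΔU
  have hΔUpos : 0 < ΔU := by rw [hPQ]; positivity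
  have hN' : (A - l • 1 - δL • 1).PosDef :=
    hN.sub_smul_one hL ((mul_le_mul_of_nonneg_left hNb hL.le).trans_lt hb)
  set M := A - l • 1 - δL • 1 with hM
  have hMN : A - l • 1 = M + δL • 1 := by rw [hM, sub_add_cancel]
  rw [hMN] at hN hNb
  have hMN1 := hN'.reTrace_inv_sub hL
  have hMNpos := hN'.reTrace_inv_mul_inv_pos hL
  have hMM := hN'.reTrace_inv_mul_self_eq hL
  have hCS := hN'.inv.reTrace_mul_sq_le hN.inv
  set ΔL := reTrace M⁻¹ - reTrace (M + δL • 1)⁻¹ with hΔL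
  have hΔLpos : 0 < ΔL := by rw [hMN1]; positivity
  -- A weight `t` is safe for the upper barrier when `t * U i ≤ 1` and for the lower one when `1 ≤ t
  -- * L i`. Comparing the sums over `i` yields an index at which both hold with `t = (L i)⁻¹`.
  let U : ι → ℝ := fun i => reForm (Q⁻¹ * Q⁻¹) (v i) / ΔU + reForm Q⁻¹ (v i)
  let L : ι → ℝ := fun i => reForm (M⁻¹ * M⁻¹) (v i) / ΔL - reForm M⁻¹ (v i)
  have hUsum : ∑ i, U i ≤ 1 / δU + a := by
    simp only [U, Finset.sum_add_distrib, ← Finset.sum_div, sum_reForm hv]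
    refine add_le_add ?_ (by linarith)
    rw [div_le_div_iff₀ hΔUpos hU, hPQ]
    nlinarith
  have hLsum : 1 / δL - b ≤ ∑ i, L i := by
    simp only [L, Finset.sum_sub_distrib, ← Finset.sum_div, sum_reForm hv]
    set β := reTrace (M⁻¹ * (M + δL • 1)⁻¹)
    set γ := reTrace (M⁻¹ * (M + δL • 1)⁻¹ * M⁻¹)
    set α := reTrace (M + δL • 1)⁻¹
    have hα : 0 < α := hN.inv.reTrace_pos
    -- Cauchy–Schwarz gives `β ^ 2 ≤ α * γ`, and `δL * α ≤ 1`; this absorbs the increase `δL * β` of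
    -- the lower potential.
    have hγ : δL * β ≤ γ / β := by
      rw [le_div_iff₀ hMNpos]
      have : δL * α ≤ 1 := (mul_le_mul_of_nonneg_left hNb hL.le).trans hb.le
      have hγ0 : 0 ≤ γ := by
        by_contra! h
        nlinarith [sq_nonneg β]
      nlinarith [mul_le_mul_of_nonneg_right this hγ0, mul_le_mul_of_nonneg_left hCS hL.le]
    have e : reTrace (M⁻¹ * M⁻¹) / ΔL = 1 / δL + γ / β := by
      rw [hMM, hMN1]; field_simp
    rw [e]
    linarith
  have hU0 : ∀ i, 0 ≤ U i := fun i => add_nonneg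
    (div_nonneg (hQ.inv.mul_self.posSemidef.reForm_nonneg _) hΔUpos.le)
    (hQ.inv.posSemidef.reForm_nonneg _)
  have hb' : 0 < 1 / δL - b := by
    rw [sub_pos, lt_div_iff₀ hL]; linarith
  obtain ⟨i, hUL, hLpos⟩ : ∃ i, U i ≤ L i ∧ 0 < L i := by
    by_contra! h
    have hle : ∀ i ∈ Finset.univ, L i ≤ U i := fun i _ => by
      rcases le_total (U i) (L i) with h1 | h1
      · exact (h i h1).trans (hU0 i)
      · exact h1
    have heq := (Finset.sum_eq_sum_iff_of_le hle).1
      (le_antisymm (Finset.sum_le_sum hle) (by linarith))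
    have : ∑ i, L i ≤ 0 := Finset.sum_nonpos fun i hi => h i (heq i hi).ge
    linarith
  have hvi : v i ≠ 0 := by
    intro h0
    simp [L, h0, reForm_zero_right] at hLpos
  have ht : 0 < (L i)⁻¹ := inv_pos.2 hLpos
  refine ⟨i, (L i)⁻¹, ht, ?_⟩
  obtain ⟨h1, h2⟩ := hQ.sub_smul_outer_of_le hvi ht hΔUpos
    (by rw [inv_mul_le_iff₀ hLpos, mul_one]; exact hUL)
  obtain ⟨h3, h4⟩ := hN'.add_smul_outer_of_le ht hΔLpos (v := v i)
    (inv_mul_cancel₀ hLpos.ne').ge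
  have e1 : (u + δU) • 1 - (A + (L i)⁻¹ • outer (v i)) = Q - (L i)⁻¹ • outer (v i) := by
    rw [hQdef, hPdef, add_smul]; abel
  have e2 : A + (L i)⁻¹ • outer (v i) - (l + δL) • 1 = M + (L i)⁻¹ • outer (v i) := by
    rw [hM, add_smul]; abel
  refine ⟨e1 ▸ h1, e2 ▸ h3, ?_, ?_⟩
  · rw [e1]; linarith
  · rw [e2]; linarith

end Barrier

end Matrix

/-! ### Iterating the step and choosing the parameters. -/

namespace Matrix

variable {n : Type*} [Fintype n] [DecidableEq n] {ι : Type*} [Fintype ι] {v : ι → n → ℂ}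

lemma BarrierBounds.iterate [Nonempty n] (hv : ∑ i, outer (v i) = 1) {l u a b δL δU : ℝ}
    (h0 : BarrierBounds (0 : Matrix n n ℂ) l u a b) (hL : 0 < δL) (hU : 0 < δU)
    (hb : δL * b < 1) (hab : 1 / δU + a ≤ 1 / δL - b) (K : ℕ) :
    ∃ (s : ι → ℝ) (T : Finset ι), (∀ i, 0 ≤ s i) ∧ (∀ i ∉ T, s i = 0) ∧ T.card ≤ K ∧
      BarrierBounds (∑ i, s i • outer (v i)) (l + K * δL) (u + K * δU) a b := by
  classical
  induction K with
  | zero => exact ⟨0, ∅, by simp, by simp, by simp, by simpa using h0⟩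
  | succ K ih =>
    obtain ⟨s, T, hs, hsT, hT, hA⟩ := ih
    obtain ⟨i, t, ht, hstep⟩ := hA.step hv hL hU hb hab
    refine ⟨s + Pi.single i t, insert i T, fun j => ?_, fun j hj => ?_,
      (Finset.card_insert_le _ _).trans (by lia), ?_⟩
    · rcases eq_or_ne j i with rfl | h
      · simpa using add_nonneg (hs j) ht.le
      · simpa [h] using hs j
    · rw [Finset.mem_insert, not_or] at hj
      simp [hj.1, hsT j hj.2]
    · have e : ∑ j, (s + (Pi.single i t : ι → ℝ)) j • outer (v j)
          = ∑ j, s j • outer (v j) + t • outer (v i) := by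
        simp only [Pi.add_apply, add_smul, Finset.sum_add_distrib]
        congr 1
        rw [Finset.sum_eq_single i] <;> simp +contextual
      rw [e]
      push_cast
      convert hstep using 1 <;> ring

lemma inv_smul_one {x : ℝ} (hx : x ≠ 0) : (x • (1 : Matrix n n ℂ))⁻¹ = x⁻¹ • 1 :=
  inv_eq_right_inv (by
    rw [smul_mul_assoc, one_mul, smul_smul, mul_inv_cancel₀ hx, one_smul])

lemma barrierBounds_zero [Nonempty n] {a b : ℝ} (ha : 0 < a) (hb : 0 < b) :
    BarrierBounds (0 : Matrix n n ℂ) (-(Fintype.card n / b)) (Fintype.card n / a) a b := by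
  have hn : (0 : ℝ) < Fintype.card n := by exact_mod_cast Fintype.card_pos
  have htr : reTrace (1 : Matrix n n ℂ) = Fintype.card n := by simp [reTrace]
  have key : ∀ {c : ℝ}, 0 < c → reTrace ((Fintype.card n / c) • (1 : Matrix n n ℂ))⁻¹ = c := by
    intro c hc
    rw [inv_smul_one (by positivity), reTrace_smul, htr]
    field_simp
  refine ⟨?_, ?_, ?_, ?_⟩
  · rw [sub_zero]; exact .smul_one (by positivity)
  · rw [neg_smul, zero_sub, neg_neg]; exact .smul_one (by positivity)
  · rw [sub_zero, key ha]
  · rw [neg_smul, zero_sub, neg_neg, key hb]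

/-- **Batson–Spielman–Srivastava**: a decomposition of the identity into rank-one Hermitian
matrices has a reweighting with `O(n / ε²)` terms that is within a factor `1 ± ε` of it. -/
theorem exists_sparse_isotropic [Nonempty n] (hv : ∑ i, outer (v i) = 1) {ε : ℝ} (hε : 0 < ε)
    (hε1 : ε < 1) :
    ∃ (s : ι → ℝ) (T : Finset ι), (∀ i, 0 ≤ s i) ∧ (∀ i ∉ T, s i = 0) ∧
      T.card * ε ^ 2 ≤ 49 * Fintype.card n ∧
      ∀ x : n → ℂ, (1 - ε) * reForm 1 x ≤ ∑ i, s i * ‖star (v i) ⬝ᵥ x‖ ^ 2 ∧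
        ∑ i, s i * ‖star (v i) ⬝ᵥ x‖ ^ 2 ≤ (1 + ε) * reForm 1 x := by
  -- Rounded up so that the number of steps `(p + 1) ^ 2 * n` is an integer. The constant 5 suffices
  -- for `(3 m + 2) / m ^ 2 ≤ ε`, and `(m + 1) ε < 7` produces the 49.
  set p := ⌈5 / ε⌉₊ with hp
  have hp5 : 5 / ε ≤ p := Nat.le_ceil _
  have hp6 : (p : ℝ) < 5 / ε + 1 := Nat.ceil_lt_add_one (by positivity)
  rw [div_le_iff₀ hε] at hp5
  have hp6' : (p : ℝ) * ε < 5 + ε := by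
    have := mul_lt_mul_of_pos_right hp6 hε
    rwa [add_mul, div_mul_cancel₀ _ hε.ne', one_mul] at this
  have hm : (1 : ℝ) ≤ p := by nlinarith
  obtain ⟨m, hmp⟩ : ∃ m : ℝ, m = p := ⟨_, rfl⟩
  rw [← hmp] at hp5 hp6' hm
  have hm0 : 0 < m := by linarith
  obtain ⟨N, hN⟩ : ∃ N : ℝ, N = Fintype.card n := ⟨_, rfl⟩
  have hNpos : 0 < N := by rw [hN]; exact_mod_cast Fintype.card_pos
  -- With `δL = 1` and `δU = (m + 2) / m`, both sides of the averaging condition equal `m / (m +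
  -- 1)`. The barriers end at `N m (m + 1)` and `N (m + 1) (m + 2) ^ 2 / m`; the factor `c` below
  -- brings both close to 1.
  have h0 := barrierBounds_zero (n := n) (a := m / ((m + 1) * (m + 2))) (b := 1 / (m + 1))
    (by positivity) (by positivity)
  obtain ⟨s, T, hs, hsT, hT, hA⟩ := h0.iterate hv one_pos (δU := (m + 2) / m) (by positivity)
    (by rw [one_mul, div_lt_one (by positivity)]; linarith)
    (le_of_eq (by field_simp; ring)) ((p + 1) ^ 2 * Fintype.card n)
  rw [← hN] at hA
  push_cast at hA
  rw [← hmp, ← hN] at hA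
  have hcpos : 0 < 1 / (N * m * (m + 2)) := by positivity
  set c := 1 / (N * m * (m + 2)) with hc
  refine ⟨fun i => c * s i, T, fun i => mul_nonneg hcpos.le (hs i), fun i hi => ?_, ?_, fun x => ?_⟩
  · simp [hsT i hi]
  · have hT' : (T.card : ℝ) ≤ (m + 1) ^ 2 * N := by
      rw [hmp, hN]; exact_mod_cast hT
    have h7 : ((m + 1) * ε) ^ 2 ≤ 49 := by
      nlinarith [mul_pos hm0 hε]
    rw [← hN]
    calc (T.card : ℝ) * ε ^ 2 ≤ (m + 1) ^ 2 * N * ε ^ 2 := by gcongr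
      _ = ((m + 1) * ε) ^ 2 * N := by ring
      _ ≤ 49 * N := by gcongr
  · have e : ∑ i, c * s i * ‖star (v i) ⬝ᵥ x‖ ^ 2 = c * reForm (∑ i, s i • outer (v i)) x := by
      rw [reForm_sum_smul_outer, Finset.mul_sum]
      exact Finset.sum_congr rfl fun i _ => by ring
    rw [e]
    have hX := (PosSemidef.one (n := n) (R := ℂ)).reForm_nonneg x
    have hu := hA.upper.posSemidef.reForm_nonneg x
    have hl := hA.lower.posSemidef.reForm_nonneg x
    rw [reForm_sub, reForm_smul, sub_nonneg] at hu hl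
    have hlow : 1 - ε ≤ c * (-(N / (1 / (m + 1))) + (m + 1) ^ 2 * N * 1) := by
      have : c * (-(N / (1 / (m + 1))) + (m + 1) ^ 2 * N * 1) = 1 - 1 / (m + 2) := by
        rw [hc]; field_simp; ring
      rw [this]
      have : 1 / (m + 2) ≤ ε := by rw [div_le_iff₀ (by positivity)]; nlinarith
      linarith
    have hupp : c * (N / (m / ((m + 1) * (m + 2))) + (m + 1) ^ 2 * N * ((m + 2) / m)) ≤ 1 + ε := by
      have : c * (N / (m / ((m + 1) * (m + 2))) + (m + 1) ^ 2 * N * ((m + 2) / m))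
          = 1 + (3 * m + 2) / m ^ 2 := by
        rw [hc]; field_simp; ring
      rw [this]
      have : (3 * m + 2) / m ^ 2 ≤ ε := by rw [div_le_iff₀ (by positivity)]; nlinarith
      linarith
    constructor
    · calc _ ≤ _ := mul_le_mul_of_nonneg_right hlow hX
        _ ≤ _ := by rw [mul_assoc]; exact mul_le_mul_of_nonneg_left hl hcpos.le
    · calc _ ≤ _ := mul_le_mul_of_nonneg_left hu hcpos.le
        _ ≤ _ := by rw [← mul_assoc]; exact mul_le_mul_of_nonneg_right hupp hX

end Matrix

/-! ### From isotropic vectors to subspaces. -/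

open Matrix in
/-- The squared coordinates on a subspace of dimension `r` can be reweighted so that only
`O(r / ε²)` of them remain and their sum changes by a factor in `1 ± ε`. -/
theorem Submodule.exists_sparse_coordinates {ι : Type*} [Fintype ι]
    (W : Submodule ℂ (EuclideanSpace ℂ ι)) {ε : ℝ} (hε : 0 < ε) (hε1 : ε < 1) :
    ∃ (s : ι → ℝ) (T : Finset ι), (∀ i, 0 ≤ s i) ∧ (∀ i ∉ T, s i = 0) ∧
      T.card * ε ^ 2 ≤ 49 * Module.finrank ℂ W ∧
      ∀ w ∈ W, (1 - ε) * ∑ i, ‖w i‖ ^ 2 ≤ ∑ i, s i * ‖w i‖ ^ 2 ∧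
        ∑ i, s i * ‖w i‖ ^ 2 ≤ (1 + ε) * ∑ i, ‖w i‖ ^ 2 := by
  rcases Nat.eq_zero_or_pos (Module.finrank ℂ W) with h0 | hpos
  · refine ⟨0, ∅, by simp, by simp, by simp, fun w hw => ?_⟩
    rw [Submodule.finrank_eq_zero] at h0
    subst h0
    rw [Submodule.mem_bot] at hw
    simp [hw]
  have : Nonempty (Fin (Module.finrank ℂ W)) := ⟨⟨0, hpos⟩⟩
  let b := stdOrthonormalBasis ℂ W
  -- The conjugated rows of the matrix whose columns are the basis vectors; orthonormality of the
  -- columns makes their outer products sum to the identity.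
  let v : ι → Fin (Module.finrank ℂ W) → ℂ := fun i k => star ((b k : EuclideanSpace ℂ ι) i)
  have hv : ∑ i, outer (v i) = 1 := by
    ext k l
    have h := orthonormal_iff_ite.1 b.orthonormal k l
    rw [Submodule.coe_inner, PiLp.inner_apply] at h
    rw [Matrix.sum_apply, Matrix.one_apply, ← h]
    refine Finset.sum_congr rfl fun i _ => ?_
    simp [outer, vecMulVec_apply, v, mul_comm]
  obtain ⟨s, T, hs, hsT, hT, h⟩ := exists_sparse_isotropic hv hε hε1
  refine ⟨s, T, hs, hsT, by simpa using hT, fun w hw => ?_⟩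
  let x : Fin (Module.finrank ℂ W) → ℂ := fun k => b.repr ⟨w, hw⟩ k
  have hwx : ∀ i, star (v i) ⬝ᵥ x = w i := fun i => by
    have h1 : ∑ k, x k • (b k : EuclideanSpace ℂ ι) = w := by
      have := congrArg Subtype.val (b.sum_repr ⟨w, hw⟩)
      simpa using this
    conv_rhs => rw [← h1]
    simp [dotProduct, v, mul_comm]
  have h1 : reForm 1 x = ∑ i, ‖w i‖ ^ 2 := by
    rw [← hv]
    have := reForm_sum_smul_outer (v := v) (fun _ => 1) x
    simpa [hwx] using this
  simpa only [hwx, h1] using h x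

/-! ### Predicates as squared moduli. -/

lemma exists_norm_eq_one_and_norm_one_add_eq_one : ∃ ω : ℂ, ‖ω‖ = 1 ∧ ‖1 + ω‖ = 1 := by
  have h3 : √3 * √3 = 3 := Real.mul_self_sqrt (by norm_num)
  refine ⟨⟨-1 / 2, √3 / 2⟩, ?_, ?_⟩ <;>
  · rw [← sq_eq_sq₀ (norm_nonneg _) zero_le_one, ← Complex.normSq_eq_norm_sq, Complex.normSq_apply]
    simp
    nlinarith

/-- A predicate with other than exactly one satisfying input is the squared modulus of an affine
function with complex coefficients. -/
lemma BoolPred.exists_norm_sq_eq (P : BoolPred)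
    (hP : P ∉ ({BoolPred.nOr, BoolPred.zeroOne, BoolPred.dicut, BoolPred.and} : Set BoolPred)) :
    ∃ a b c : ℂ, ∀ x y : Bool,
      ‖a + (if x then b else 0) + (if y then c else 0)‖ ^ 2 = if P x y = true then (1 : ℝ) else 0 := by
  obtain ⟨ω, hω, hω'⟩ := exists_norm_eq_one_and_norm_one_add_eq_one
  simp only [Set.mem_insert_iff, Set.mem_singleton_iff, funext_iff, Bool.forall_bool,
    BoolPred.nOr, BoolPred.zeroOne, BoolPred.dicut, BoolPred.and] at hP
  simp only [Bool.forall_bool]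
  generalize P false false = p₀₀ at *
  generalize P false true = p₀₁ at *
  generalize P true false = p₁₀ at *
  generalize P true true = p₁₁ at *
  cases p₀₀ <;> cases p₀₁ <;> cases p₁₀ <;> cases p₁₁ <;> simp at hP
  · exact ⟨0, 0, 0, by simp⟩
  · exact ⟨0, 1, 0, by simp⟩
  · exact ⟨0, 0, 1, by simp⟩
  · exact ⟨0, 1, -1, by simp⟩
  · exact ⟨0, 1, ω, by simp [hω, hω']⟩
  · exact ⟨1, -1, -1, by simp⟩
  · exact ⟨1, 0, -1, by simp⟩
  · exact ⟨1, ω, -1, by simp [hω, hω']⟩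
  · exact ⟨1, -1, 0, by simp⟩
  · exact ⟨1, -1, ω, by simp [hω, hω']⟩
  · exact ⟨1 + ω, -1, -ω, by simp [hω, hω']⟩
  · exact ⟨1, 0, 0, by simp⟩

/-! ### Sparsifying instances. -/

namespace BinVCSP

variable {V : Type*}

/-- The sub-instance on the constraints in `T`, the weight of each multiplied by `s`. -/
noncomputable def reweight (I : BinVCSP V) (s : {π : BinConstraint V // π ∈ I.constraints} → ℝ≥0)
    (T : Finset {π : BinConstraint V // π ∈ I.constraints}) : BinVCSP V where
  constraints := T.map (Function.Embedding.subtype _)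
  weight π :=
    have h : π.1 ∈ I.constraints := by
      obtain ⟨ρ, -, hρ⟩ := Finset.mem_map.1 π.2
      exact hρ ▸ ρ.2
    s ⟨π.1, h⟩ * I.weight ⟨π.1, h⟩

lemma value_reweight (I : BinVCSP V) {s : {π : BinConstraint V // π ∈ I.constraints} → ℝ≥0}
    {T : Finset {π : BinConstraint V // π ∈ I.constraints}} (hs : ∀ π ∉ T, s π = 0)
    (A : V → Bool) :
    (I.reweight s T).value A = ∑ π : {π : BinConstraint V // π ∈ I.constraints},
      (s π : ℝ) * ((I.weight π : ℝ) * (if π.1.Satisfied A then 1 else 0)) := by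
  classical
  rw [← Finset.sum_subset (Finset.subset_univ T) fun π _ hπ => by simp [hs π hπ],
    ← Finset.sum_coe_sort T, value]
  refine (Fintype.sum_bijective
    (fun π : T => (⟨π.1.1, Finset.mem_map_of_mem _ π.2⟩ : {π // π ∈ (I.reweight s T).constraints}))
    ⟨fun π ρ h => Subtype.ext (Subtype.ext (Subtype.mk.inj h)), fun π => ?_⟩ _ _
    fun π => ?_).symm
  · obtain ⟨ρ, hρ, h⟩ := Finset.mem_map.1 π.2
    exact ⟨⟨ρ, hρ⟩, Subtype.ext h⟩
  · simp only [reweight, NNReal.coe_mul, mul_assoc]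

lemma exists_isSparsifier [Fintype V] {ε : ℝ} (hε : 0 < ε) (hε1 : ε < 1) (I : BinVCSP V)
    (hI : ∀ π ∈ I.constraints,
      π.pred ∉ ({BoolPred.nOr, BoolPred.zeroOne, BoolPred.dicut, BoolPred.and} : Set BoolPred)) :
    ∃ J : BinVCSP V, J.IsSparsifier ε I ∧
      (J.constraints.card : ℝ) * ε ^ 2 ≤ 49 * (Fintype.card V + 1) := by
  choose a b c habc using fun π : {π : BinConstraint V // π ∈ I.constraints} =>
    π.1.pred.exists_norm_sq_eq (hI π.1 π.2)
  -- The coordinate `none` homogenises the constant term `a` and is set to 1 for assignments; it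
  -- accounts for the `+ 1` in the dimension.
  let F : (Option V → ℂ) →ₗ[ℂ] EuclideanSpace ℂ {π : BinConstraint V // π ∈ I.constraints} :=
    (WithLp.linearEquiv 2 ℂ _).symm.toLinearMap ∘ₗ LinearMap.pi fun π =>
      ((√(I.weight π) : ℝ) : ℂ) • (a π • LinearMap.proj none + b π • LinearMap.proj (some π.1.fst)
        + c π • LinearMap.proj (some π.1.snd))
  obtain ⟨s, T, hs, hsT, hT, h⟩ := (LinearMap.range F).exists_sparse_coordinates hε hε1
  have hval : ∀ (A : V → Bool) (π : {π : BinConstraint V // π ∈ I.constraints}),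
      ‖F (fun o => o.elim 1 fun x => if A x then 1 else 0) π‖ ^ 2
        = (I.weight π : ℝ) * (if π.1.Satisfied A then 1 else 0) := fun A π => by
    change _ = (I.weight π : ℝ) * (if π.1.pred (A π.1.fst) (A π.1.snd) = true then 1 else 0)
    have e : F (fun o => o.elim 1 fun x => if A x then 1 else 0) π = ((√(I.weight π) : ℝ) : ℂ) *
        (a π + (if A π.1.fst then b π else 0) + (if A π.1.snd then c π else 0)) := by
      simp [F, mul_add]
    rw [← habc, e, norm_mul, mul_pow, Complex.norm_real, Real.norm_eq_abs, sq_abs,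
      Real.sq_sqrt (I.weight π).coe_nonneg]
  lift s to {π : BinConstraint V // π ∈ I.constraints} → ℝ≥0 using hs
  refine ⟨I.reweight s T, ⟨?_, fun A => ?_⟩, ?_⟩
  · intro π hπ
    obtain ⟨ρ, -, rfl⟩ := Finset.mem_map.1 hπ
    exact ρ.2
  · have hA := h _ (LinearMap.mem_range_self F fun o => o.elim 1 fun x => if A x then 1 else 0)
    simp only [hval] at hA
    rw [value_reweight I (fun π hπ => by simpa using hsT π hπ), Set.mem_Icc, value]
    exact hA
  · have hr : Module.finrank ℂ (LinearMap.range F) ≤ Fintype.card V + 1 :=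
      (LinearMap.finrank_range_le F).trans (by simp)
    have hr' : (Module.finrank ℂ (LinearMap.range F) : ℝ) ≤ Fintype.card V + 1 := by
      exact_mod_cast hr
    rw [reweight, Finset.card_map]
    linarith

end BinVCSP

theorem mainTheorem5 :
    ∃ C : ℝ, 0 < C ∧
      ∀ (V : Type*) [Fintype V] (ε : ℝ), 0 < ε → ε < 1 →
        ∀ I : BinVCSP V,
          (∀ π ∈ I.constraints,
            π.pred ∉ ({BoolPred.nOr, BoolPred.zeroOne, BoolPred.dicut, BoolPred.and} :
              Set BoolPred)) →
          ∃ J : BinVCSP V,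
            J.IsSparsifier ε I ∧
              (J.constraints.card : ℝ) ≤ C * ((Fintype.card V : ℝ) / ε ^ 2) := by
  -- For nonempty `V`, `49 (|V| + 1) ≤ 98 |V|`; for empty `V` there are no constraints.
  refine ⟨98, by norm_num, fun V _ ε hε hε1 I hI => ?_⟩
  obtain ⟨J, hJ, hcard⟩ := I.exists_isSparsifier hε hε1 hI
  refine ⟨J, hJ, ?_⟩
  rcases isEmpty_or_nonempty V with hV | hV
  · have : J.constraints = ∅ := Finset.eq_empty_of_forall_notMem fun π _ => hV.elim π.fst
    simp [this]
  · have : (1 : ℝ) ≤ Fintype.card V := by exact_mod_cast Fintype.card_pos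
    rw [← mul_div_assoc, le_div_iff₀ (by positivity)]
    linarith
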